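/- Let $D$ be a set of $n\ge 3$ points ("dots") in the Euclidean plane, or in a round sphere in $\mathbb{R}^3$, in general position: no four dots lie on a circle and, in the case of the plane, no three dots lie on a line. Let $k,\ell\ge 0$ be integers with $k+\ell=n-3$. Every circle $C$ (in the plane, respectively in the sphere) has two sides: its inside and outside in the plane, and the two open caps that it bounds in the sphere. Then the number of circles through three of the dots which have exactly $k$ of the remaining dots on one side and exactly $\ell$ on the other side (the two sides not being distinguished) is $$\begin{cases}2(k+1)(\ell+1) & \text{if } k\ne \ell,\\ (k+1)^2 & \text{if } k=\ell.\end{cases}$$ -/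

import Mathlib

namespace Dots

/-- The Euclidean plane. -/
abbrev Plane := EuclideanSpace ℝ (Fin 2)

/-- Euclidean three-space, in which the spheres live. -/
abbrev Space := EuclideanSpace ℝ (Fin 3)

/-- `C` is a circle in the plane (of positive radius). -/
def IsPlaneCircle (C : Set Plane) : Prop :=
  ∃ (c : Plane) (r : ℝ), 0 < r ∧ C = Metric.sphere c r

/-- `A` and `B` are, in one of the two orders, the inside and the outside of the circle `C`
in the plane. -/
def ArePlaneSides (C A B : Set Plane) : Prop :=
  ∃ (c : Plane) (r : ℝ), 0 < r ∧ C = Metric.sphere c r ∧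
    ((A = {x | dist x c < r} ∧ B = {x | r < dist x c}) ∨
      (A = {x | r < dist x c} ∧ B = {x | dist x c < r}))

/-- `C` is a circle in the sphere with centre `o` and radius `R`: the intersection of that sphere
with an affine plane `⟪v, x⟫ = t`, `v ≠ 0`, that meets the sphere in more than one point
(so `C` is neither empty nor a point of tangency). -/
def IsSphereCircle (o : Space) (R : ℝ) (C : Set Space) : Prop :=
  C.Nontrivial ∧ ∃ (v : Space) (t : ℝ), v ≠ 0 ∧ C = {x ∈ Metric.sphere o R | inner ℝ v x = t}

/-- `A` and `B` are the two sides, in either order, of the circle `C` in the sphere with centre `o`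
and radius `R`: the two open caps into which the plane of `C` cuts the sphere.
(Both orders are included, as `(v, t)` may be replaced by `(-v, -t)`.) -/
def AreSphereSides (o : Space) (R : ℝ) (C A B : Set Space) : Prop :=
  C.Nontrivial ∧ ∃ (v : Space) (t : ℝ), v ≠ 0 ∧
    C = {x ∈ Metric.sphere o R | inner ℝ v x = t} ∧
    A = {x ∈ Metric.sphere o R | inner ℝ v x < t} ∧
    B = {x ∈ Metric.sphere o R | t < inner ℝ v x}

/-- Dots in the plane are in general position: no four on a circle, no three on a line. -/
def PlaneGeneralPosition (D : Finset Plane) : Prop :=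
  (∀ T ⊆ D, T.card = 4 → ∀ C, IsPlaneCircle C → ¬ (T : Set Plane) ⊆ C) ∧
    ∀ T ⊆ D, T.card = 3 → ¬ Collinear ℝ (T : Set Plane)

/-- Dots in the sphere with centre `o` and radius `R` are in general position:
no four on a circle. -/
def SphereGeneralPosition (o : Space) (R : ℝ) (D : Finset Space) : Prop :=
  ∀ T ⊆ D, T.card = 4 → ∀ C, IsSphereCircle o R C → ¬ (T : Set Space) ⊆ C

/-- The circles in the plane through three of the dots of `D` with `k` dots of `D` on one side and
`l` dots of `D` on the other side. -/
def planeIncidentCircles (D : Finset Plane) (k l : ℕ) : Set (Set Plane) :=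
  {C | IsPlaneCircle C ∧ (∃ T ⊆ D, T.card = 3 ∧ (T : Set Plane) ⊆ C) ∧
    ∃ A B, ArePlaneSides C A B ∧
      ((D : Set Plane) ∩ A).ncard = k ∧ ((D : Set Plane) ∩ B).ncard = l}

/-- The circles in the sphere with centre `o` and radius `R` through three of the dots of `D` with
`k` dots of `D` on one side and `l` dots of `D` on the other side. -/
def sphereIncidentCircles (o : Space) (R : ℝ) (D : Finset Space) (k l : ℕ) : Set (Set Space) :=
  {C | IsSphereCircle o R C ∧ (∃ T ⊆ D, T.card = 3 ∧ (T : Set Space) ⊆ C) ∧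
    ∃ A B, AreSphereSides o R C A B ∧
      ((D : Set Space) ∩ A).ncard = k ∧ ((D : Set Space) ∩ B).ncard = l}

end Dots

/-! Circles are zero sets of functions in a four-dimensional real space: `q‖x‖² + ⟪m, x⟫ + t` in the
plane, affine functions restricted to the sphere in space. This space contains the constants, a
linear height separating the dots, and for each dot a function vanishing there and positive at all
other dots (convex position); `CircleFamily` records this.

Each circle through three dots has a middle dot `v`, with `a` above and `b` below it. The functions
vanishing at `v` form a three-dimensional space containing the supporting function `t` and the
height difference `e`. Scale each circle function at `v` to take the value 1 under a functional that
kills `t` and `e`. Two of them then differ by `c t + d e`, which is zero or has a strict sign on all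
dots above or on all dots below `v`. A strict sign makes the positive counts on that part differ, so
the two counts determine `(a, b)` (`exists_fan`).

As there are as many pairs `(a, b)` as possible pairs of counts, every pair of counts occurs exactly
once (`IsFan.exists_posCount`). Summing over `v` gives `(s + 1)(m + 1)` scaled functions with `s`
positive and `m` negative dots (`IsFan.card_flags_posCount`). Forgetting orientation, a circle is
counted for `s = k` or `s = l`, whence the two cases. -/

namespace Dots

/-! ### Circle families and the fan of circles at a middle dot -/

section Abstract

variable {X P : Type*} [AddCommGroup P] [Module ℝ P]

/-- Passing from `f` to `g` loses no positive point and gains `a`. The zero has to belong to the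
smaller function. -/
lemma card_filter_pos_lt {A : Finset X} {f g : X → ℝ} (hfg : ∀ x ∈ A, f x < g x) {a : X}
    (ha : a ∈ A) (hfa : f a = 0) :
    (A.filter fun x => 0 < f x).card < (A.filter fun x => 0 < g x).card := by
  apply Finset.card_lt_card
  rw [Finset.ssubset_iff_of_subset]
  · refine ⟨a, ?_, ?_⟩
    · simp only [Finset.mem_filter]
      exact ⟨ha, hfa ▸ hfg a ha⟩
    · simp [hfa]
  · intro x hx
    simp only [Finset.mem_filter] at hx ⊢
    exact ⟨hx.1, hx.2.trans (hfg x hx.1)⟩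

/-- A combination of a function positive on `A ∪ B` and a function positive on `A` and negative
on `B` has a strict sign on `A` or on `B`, or is zero. -/
lemma combination_strict_sign {A B : Finset X} {t e : X → ℝ} (htA : ∀ x ∈ A, 0 < t x)
    (htB : ∀ x ∈ B, 0 < t x) (heA : ∀ x ∈ A, 0 < e x) (heB : ∀ x ∈ B, e x < 0) (c d : ℝ) :
    (c = 0 ∧ d = 0) ∨ (∀ x ∈ A, 0 < c * t x + d * e x) ∨ (∀ x ∈ A, c * t x + d * e x < 0) ∨
      (∀ x ∈ B, 0 < c * t x + d * e x) ∨ (∀ x ∈ B, c * t x + d * e x < 0) := by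
  rcases lt_trichotomy c 0 with hc | hc | hc
  · rcases le_or_gt d 0 with hd | hd
    · right; right; left
      intro x hx
      nlinarith [mul_pos (neg_pos.2 hc) (htA x hx), mul_nonneg (neg_nonneg.2 hd) (heA x hx).le]
    · right; right; right; right
      intro x hx
      nlinarith [mul_pos (neg_pos.2 hc) (htB x hx), mul_pos hd (neg_pos.2 (heB x hx))]
  · subst hc
    rcases lt_trichotomy d 0 with hd | hd | hd
    · right; right; left
      intro x hx
      nlinarith [mul_pos (neg_pos.2 hd) (heA x hx)]
    · exact Or.inl ⟨rfl, hd⟩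
    · right; left
      intro x hx
      nlinarith [mul_pos hd (heA x hx)]
  · rcases le_or_gt 0 d with hd | hd
    · right; left
      intro x hx
      nlinarith [mul_pos hc (htA x hx), mul_nonneg hd (heA x hx).le]
    · right; right; right; left
      intro x hx
      nlinarith [mul_pos hc (htB x hx), mul_pos (neg_pos.2 hd) (neg_pos.2 (heB x hx))]

/-- The linear system in `c`, `d` has nonzero determinant by the sign pattern. Hence no nontrivial
combination of the supporting and height functions vanishes at a dot above and a dot below. -/
lemma coefficients_eq_zero {t₁ t₂ e₁ e₂ c d : ℝ} (ht₁ : 0 < t₁) (ht₂ : 0 < t₂) (he₁ : 0 < e₁)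
    (he₂ : e₂ < 0) (h₁ : c * t₁ + d * e₁ = 0) (h₂ : c * t₂ + d * e₂ = 0) : c = 0 ∧ d = 0 := by
  have hd : d * (e₁ * t₂ - e₂ * t₁) = 0 := by linear_combination t₂ * h₁ - t₁ * h₂
  have hpos : 0 < e₁ * t₂ - e₂ * t₁ := by
    nlinarith [mul_pos he₁ ht₂, mul_pos (neg_pos.2 he₂) ht₁]
  have hd0 : d = 0 := (mul_eq_zero.1 hd).resolve_right hpos.ne'
  subst hd0
  exact ⟨by simpa [ht₁.ne'] using h₁, rfl⟩

/-- A four-dimensional family `ev` of functions whose zero sets are the "circles", together with a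
height function `h` that separates the dots of `D`, such that the dots are in general position and
in strictly convex position. -/
structure CircleFamily (ev : P →ₗ[ℝ] X → ℝ) (D : Finset X) (h : X → ℝ) : Prop where
  finrank : Module.finrank ℝ P = 4
  height_injOn : Set.InjOn h D
  general : ∀ p, p ≠ 0 → (D.filter fun x => ev p x = 0).card ≤ 3
  const : ∃ p, ∀ x, ev p x = 1
  height : ∃ p, ∀ x, ev p x = h x
  support : ∀ v ∈ D, ∃ p, ev p v = 0 ∧ ∀ x ∈ D, x ≠ v → 0 < ev p x

variable {ev : P →ₗ[ℝ] X → ℝ} {D : Finset X} {h : X → ℝ}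

namespace CircleFamily

lemma exists_vanishing (H : CircleFamily ev D h) (x y z : X) :
    ∃ p, p ≠ 0 ∧ ev p x = 0 ∧ ev p y = 0 ∧ ev p z = 0 := by
  have : FiniteDimensional ℝ P := Module.finite_of_finrank_pos (by rw [H.finrank]; norm_num)
  let L : P →ₗ[ℝ] Fin 3 → ℝ := LinearMap.pi fun i => (LinearMap.proj (![x, y, z] i)).comp ev
  have hL : LinearMap.ker L ≠ ⊥ := LinearMap.ker_ne_bot_of_finrank_lt (by simp [H.finrank])
  obtain ⟨p, hp, hp0⟩ := (Submodule.ne_bot_iff _).1 hL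
  have h' : ∀ i, ev p (![x, y, z] i) = 0 := fun i => congrFun (LinearMap.mem_ker.1 hp) i
  exact ⟨p, hp0, h' 0, h' 1, h' 2⟩

/-- The circle functions vanishing at `v`, the horizontal ones included, are three-dimensional:
modulo the supporting and the height function they are detected by one functional. -/
lemma exists_functional (H : CircleFamily ev D h) {v a b : X} (hv : v ∈ D) (ha : a ∈ D)
    (hb : b ∈ D) (hva : h v < h a) (hbv : h b < h v) :
    ∃ (t e : P) (r : P →ₗ[ℝ] ℝ), (∀ x ∈ D, x ≠ v → 0 < ev t x) ∧ ev t v = 0 ∧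
      (∀ x, ev e x = h x - h v) ∧
      ∀ p, ev p v = 0 → r p = 0 → ∃ c d : ℝ, p = c • t + d • e := by
  have : FiniteDimensional ℝ P := Module.finite_of_finrank_pos (by rw [H.finrank]; norm_num)
  obtain ⟨one, hone⟩ := H.const
  obtain ⟨g, hg⟩ := H.height
  obtain ⟨t, htv, ht⟩ := H.support v hv
  have hta := ht a ha (by rintro rfl; exact lt_irrefl _ hva)
  have htb := ht b hb (by rintro rfl; exact lt_irrefl _ hbv)
  set e : P := g - h v • one with he_def
  have he : ∀ x, ev e x = h x - h v := by intro x; simp [he_def, hone, hg]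
  -- Evaluation at `v` isolates the constant; evaluation at `a` and `b` then separates `t` from `e`.
  have hli : LinearIndependent ℝ ![one, t, e] := by
    rw [Fintype.linearIndependent_iff]
    intro c hc
    simp only [Fin.sum_univ_three, Matrix.cons_val_zero, Matrix.cons_val_one,
      Matrix.cons_val] at hc
    have hev : ∀ x, c 0 + c 1 * ev t x + c 2 * (h x - h v) = 0 := by
      intro x
      simpa [hone, he] using congrArg (fun p => ev p x) hc
    have h0 : c 0 = 0 := by simpa [htv] using hev v
    have hA := hev a
    have hB := hev b
    rw [h0, zero_add] at hA hB
    obtain ⟨h1, h2⟩ := coefficients_eq_zero hta htb (sub_pos.2 hva) (sub_neg.2 hbv) hA hB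
    intro i
    fin_cases i <;> assumption
  let S : Submodule ℝ P := Submodule.span ℝ (Set.range ![one, t, e])
  have hS : Module.finrank ℝ S = 3 := by
    simpa using finrank_span_eq_card hli
  have hSlt : S < ⊤ := by
    apply Submodule.lt_top_of_finrank_lt_finrank
    rw [hS, H.finrank]; norm_num
  -- The span is a hyperplane, so it is the whole kernel of `r`. For `p` vanishing at `v` the
  -- coefficient of `one` is zero, leaving only `t` and `e`.
  obtain ⟨r, hr0, hr⟩ := S.exists_le_ker_of_lt_top hSlt
  have hker : S = LinearMap.ker r := by
    apply Submodule.eq_of_le_of_finrank_le hr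
    have h1 := LinearMap.finrank_range_add_finrank_ker r
    have h2 : LinearMap.range r = ⊤ := LinearMap.range_eq_top.2 (LinearMap.surjective hr0)
    rw [h2, H.finrank] at h1
    simp at h1
    omega
  refine ⟨t, e, r, ht, htv, he, fun p hpv hrp => ?_⟩
  have hpS : p ∈ S := by rw [hker]; exact hrp
  obtain ⟨c, hc⟩ := (Submodule.mem_span_range_iff_exists_fun ℝ).1 hpS
  simp only [Fin.sum_univ_three, Matrix.cons_val_zero, Matrix.cons_val_one, Matrix.cons_val] at hc
  have h0 : c 0 = 0 := by
    rw [← hc] at hpv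
    simpa [hone, htv, he] using hpv
  exact ⟨c 1, c 2, by rw [← hc, h0]; simp⟩

/-- The dots above `v`. -/
noncomputable def above (D : Finset X) (h : X → ℝ) (v : X) : Finset X := D.filter fun x => h v < h x

/-- The dots below `v`. -/
noncomputable def below (D : Finset X) (h : X → ℝ) (v : X) : Finset X := D.filter fun x => h x < h v

/-- The number of elements of `A` on the positive side of `p`. -/
noncomputable def posCount (ev : P →ₗ[ℝ] X → ℝ) (A : Finset X) (p : P) : ℕ :=
  (A.filter fun x => 0 < ev p x).card

lemma mem_above {v x : X} : x ∈ above D h v ↔ x ∈ D ∧ h v < h x := by simp [above]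

lemma mem_below {v x : X} : x ∈ below D h v ↔ x ∈ D ∧ h x < h v := by simp [below]

lemma eq_of_zeros (H : CircleFamily ev D h) {p : P} (hp : p ≠ 0) {v a b x : X} (hv : v ∈ D)
    (ha : a ∈ above D h v) (hb : b ∈ below D h v) (hpv : ev p v = 0) (hpa : ev p a = 0)
    (hpb : ev p b = 0) (hx : x ∈ D) (hpx : ev p x = 0) : x = v ∨ x = a ∨ x = b := by
  classical
  by_contra! hne
  rw [mem_above] at ha
  rw [mem_below] at hb
  have hav : a ≠ v := by rintro rfl; exact lt_irrefl _ ha.2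
  have hbv : b ≠ v := by rintro rfl; exact lt_irrefl _ hb.2
  have hab : a ≠ b := by rintro rfl; exact lt_asymm ha.2 hb.2
  have hsub : ({x, v, a, b} : Finset X) ⊆ D.filter fun x => ev p x = 0 := by
    intro y hy
    simp only [Finset.mem_insert, Finset.mem_singleton] at hy
    rw [Finset.mem_filter]
    rcases hy with rfl | rfl | rfl | rfl
    · exact ⟨hx, hpx⟩
    · exact ⟨hv, hpv⟩
    · exact ⟨ha.1, hpa⟩
    · exact ⟨hb.1, hpb⟩
  have h4 : ({x, v, a, b} : Finset X).card = 4 := by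
    rw [Finset.card_insert_of_notMem, Finset.card_insert_of_notMem, Finset.card_pair hab]
    · simp [hav.symm, hbv.symm]
    · simp [hne.1, hne.2.1, hne.2.2]
  have := Finset.card_le_card hsub
  have := H.general p hp
  omega

/-- The circles through `v`, a dot `a` above and a dot `b` below can be so oriented that the
numbers of dots above and below `v` on the positive side determine the pair `(a, b)`. -/
lemma exists_fan (H : CircleFamily ev D h) {v : X} (hv : v ∈ D) :
    ∃ F : X → X → P,
      (∀ a ∈ above D h v, ∀ b ∈ below D h v, F a b ≠ 0 ∧ ev (F a b) v = 0 ∧ ev (F a b) a = 0 ∧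
        ev (F a b) b = 0) ∧
      (∀ a ∈ above D h v, ∀ b ∈ below D h v, ∀ p, ev p v = 0 → ev p a = 0 → ev p b = 0 →
        ∃ s : ℝ, p = s • F a b) ∧
      ∀ a ∈ above D h v, ∀ b ∈ below D h v, ∀ a' ∈ above D h v, ∀ b' ∈ below D h v,
        posCount ev (above D h v) (F a b) = posCount ev (above D h v) (F a' b') →
        posCount ev (below D h v) (F a b) = posCount ev (below D h v) (F a' b') →
        a = a' ∧ b = b' := by
  by_cases hne : (above D h v).Nonempty ∧ (below D h v).Nonempty
  swap
  · have hempty : ∀ a ∈ above D h v, ∀ b ∈ below D h v, False :=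
      fun a ha b hb => hne ⟨⟨a, ha⟩, ⟨b, hb⟩⟩
    exact ⟨fun _ _ => 0, fun a ha b hb => (hempty a ha b hb).elim,
      fun a ha b hb => (hempty a ha b hb).elim, fun a ha b hb => (hempty a ha b hb).elim⟩
  obtain ⟨⟨a₀, ha₀⟩, ⟨b₀, hb₀⟩⟩ := hne
  rw [mem_above] at ha₀
  rw [mem_below] at hb₀
  obtain ⟨t, e, r, ht, htv, he, hr⟩ := H.exists_functional hv ha₀.1 hb₀.1 ha₀.2 hb₀.2
  have htA : ∀ x ∈ above D h v, 0 < ev t x := fun x hx => by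
    rw [mem_above] at hx
    exact ht x hx.1 (by rintro rfl; exact lt_irrefl _ hx.2)
  have htB : ∀ x ∈ below D h v, 0 < ev t x := fun x hx => by
    rw [mem_below] at hx
    exact ht x hx.1 (by rintro rfl; exact lt_irrefl _ hx.2)
  have heA : ∀ x ∈ above D h v, 0 < ev e x := fun x hx => by
    rw [he]; exact sub_pos.2 (mem_above.1 hx).2
  have heB : ∀ x ∈ below D h v, ev e x < 0 := fun x hx => by
    rw [he]; exact sub_neg.2 (mem_below.1 hx).2
  have hzero : ∀ a ∈ above D h v, ∀ b ∈ below D h v, ∀ p, ev p v = 0 → ev p a = 0 →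
      ev p b = 0 → r p = 0 → p = 0 := by
    intro a ha b hb p hpv hpa hpb hrp
    obtain ⟨c, d, rfl⟩ := hr p hpv hrp
    simp only [map_add, map_smul, Pi.add_apply, Pi.smul_apply, smul_eq_mul] at hpa hpb
    obtain ⟨rfl, rfl⟩ :=
      coefficients_eq_zero (htA a ha) (htB b hb) (heA a ha) (heB b hb) hpa hpb
    simp
  have hF : ∀ a b, ∃ p, a ∈ above D h v → b ∈ below D h v →
      ev p v = 0 ∧ ev p a = 0 ∧ ev p b = 0 ∧ r p = 1 := by
    intro a b
    obtain ⟨p, hp, hpv, hpa, hpb⟩ := H.exists_vanishing v a b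
    -- Normalising `r` to 1 fixes the scale and, above all, the orientation.
    refine ⟨(r p)⁻¹ • p, fun ha hb => ?_⟩
    have hrp : r p ≠ 0 := fun h0 => hp (hzero a ha b hb p hpv hpa hpb h0)
    simp [hpv, hpa, hpb, hrp]
  choose F hF using hF
  have hF0 : ∀ a ∈ above D h v, ∀ b ∈ below D h v, F a b ≠ 0 := fun a ha b hb h0 => by
    have := (hF a b ha hb).2.2.2
    simp [h0] at this
  refine ⟨F, fun a ha b hb => ?_, fun a ha b hb p hpv hpa hpb => ⟨r p, ?_⟩, ?_⟩
  · obtain ⟨h1, h2, h3, -⟩ := hF a b ha hb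
    exact ⟨hF0 a ha b hb, h1, h2, h3⟩
  · obtain ⟨h1, h2, h3, h4⟩ := hF a b ha hb
    refine sub_eq_zero.1 (hzero a ha b hb _ ?_ ?_ ?_ ?_) <;> simp [*]
  · intro a ha b hb a' ha' b' hb' hA hB
    obtain ⟨h1, h2, h3, h4⟩ := hF a b ha hb
    obtain ⟨h1', h2', h3', h4'⟩ := hF a' b' ha' hb'
    -- Both functions have `r = 1`, so their difference is killed by `r`.
    obtain ⟨c, d, hcd⟩ := hr (F a b - F a' b') (by simp [h1, h1']) (by simp [h4, h4'])
    have hdiff : ∀ x, ev (F a b) x - ev (F a' b') x = c * ev t x + d * ev e x := fun x => by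
      simpa using congrArg (fun p => ev p x) hcd
    rcases combination_strict_sign htA htB heA heB c d with ⟨rfl, rfl⟩ | hs | hs | hs | hs
    · have heq : F a b = F a' b' := by simpa [sub_eq_zero] using hcd
      rw [← heq] at h2' h3'
      have haD := mem_above.1 ha
      have hbD := mem_below.1 hb
      have ha'D := mem_above.1 ha'
      have hb'D := mem_below.1 hb'
      constructor
      · rcases H.eq_of_zeros (hF0 a ha b hb) hv ha hb h1 h2 h3 ha'D.1 h2' with h | h | h
        · subst h; exact absurd ha'D.2 (lt_irrefl _)
        · exact h.symm
        · subst h; exact absurd ha'D.2 hbD.2.asymm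
      · rcases H.eq_of_zeros (hF0 a ha b hb) hv ha hb h1 h2 h3 hb'D.1 h3' with h | h | h
        · subst h; exact absurd hb'D.2 (lt_irrefl _)
        · subst h; exact absurd hb'D.2 haD.2.asymm
        · exact h.symm
    -- In each strict case the smaller of the two functions has its own zero (`a` or `a'`, `b` or
    -- `b'`) in the part concerned, so the counts there differ.
    · exact absurd hA.symm (card_filter_pos_lt
        (fun x hx => by have := hs x hx; rw [← hdiff] at this; linarith) ha' h2').ne
    · exact absurd hA (card_filter_pos_lt
        (fun x hx => by have := hs x hx; rw [← hdiff] at this; linarith) ha h2).ne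
    · exact absurd hB.symm (card_filter_pos_lt
        (fun x hx => by have := hs x hx; rw [← hdiff] at this; linarith) hb' h3').ne
    · exact absurd hB (card_filter_pos_lt
        (fun x hx => by have := hs x hx; rw [← hdiff] at this; linarith) hb h3).ne

end CircleFamily
end Abstract
end Dots

namespace Dots

/-! ### Counting flags and circles -/

section Counting

variable {X P : Type*} [AddCommGroup P] [Module ℝ P]
variable {ev : P →ₗ[ℝ] X → ℝ} {D : Finset X} {h : X → ℝ}

namespace CircleFamily

lemma card_above_add_card_below (H : CircleFamily ev D h) {v : X} (hv : v ∈ D) :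
    (above D h v).card + (below D h v).card + 1 = D.card := by
  classical
  rw [← Finset.card_filter_add_card_filter_not (s := D) (fun x => h v < h x), add_assoc]
  congr 1
  rw [← Finset.card_insert_of_notMem (a := v) (s := below D h v) (by simp [mem_below])]
  congr 1
  ext x
  simp only [Finset.mem_insert, mem_below, Finset.mem_filter, not_lt]
  constructor
  · rintro (rfl | hx)
    · exact ⟨hv, le_rfl⟩
    · exact ⟨hx.1, hx.2.le⟩
  · rintro ⟨hx, hle⟩
    rcases hle.eq_or_lt with heq | hlt
    · exact Or.inl (H.height_injOn hx hv heq)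
    · exact Or.inr ⟨hx, hlt⟩

lemma card_above_lt {v w : X} (hw : w ∈ D) (hvw : h v < h w) :
    (above D h w).card < (above D h v).card := by
  apply Finset.card_lt_card
  rw [Finset.ssubset_iff_of_subset]
  · exact ⟨w, mem_above.2 ⟨hw, hvw⟩, by simp [mem_above]⟩
  · intro x hx
    rw [mem_above] at hx ⊢
    exact ⟨hx.1, hvw.trans hx.2⟩

lemma card_above_injOn (H : CircleFamily ev D h) {v w : X} (hv : v ∈ D) (hw : w ∈ D)
    (hvw : (above D h v).card = (above D h w).card) : v = w := by
  rcases lt_trichotomy (h v) (h w) with hlt | heq | hlt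
  · exact absurd hvw (card_above_lt hw hlt).ne'
  · exact H.height_injOn hv hw heq
  · exact absurd hvw (card_above_lt hv hlt).ne

/-- Ranks by height are distinct and below `D.card`, so by cardinality each rank is attained. -/
lemma exists_card_above (H : CircleFamily ev D h) {i : ℕ} (hi : i < D.card) :
    ∃ v ∈ D, (above D h v).card = i := by
  have hsurj := Finset.surjOn_of_injOn_of_card_le (s := D) (t := Finset.range D.card)
    (fun v => (above D h v).card)
    (fun v hv => by
      have := H.card_above_add_card_below hv
      simp only [Finset.coe_range, Set.mem_Iio]
      omega)
    (fun v hv w hw hvw => H.card_above_injOn hv hw hvw) (by simp)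
  obtain ⟨v, hv, hvi⟩ := hsurj (show i ∈ (Finset.range D.card : Set ℕ) by simpa using hi)
  exact ⟨v, hv, hvi⟩

/-- Triples `(v, a, b)` of dots with `a` above `v` and `b` below `v`. -/
noncomputable def flags (D : Finset X) (h : X → ℝ) : Finset (X × X × X) := by
  classical
  exact (D ×ˢ D ×ˢ D).filter fun θ => θ.2.1 ∈ above D h θ.1 ∧ θ.2.2 ∈ below D h θ.1

lemma mem_flags {v a b : X} :
    (v, a, b) ∈ flags D h ↔ v ∈ D ∧ a ∈ above D h v ∧ b ∈ below D h v := by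
  simp only [flags, Finset.mem_filter, Finset.mem_product, mem_above, mem_below]
  tauto

/-- A choice of circle functions for all flags, with the properties of `exists_fan`. -/
structure IsFan (ev : P →ₗ[ℝ] X → ℝ) (D : Finset X) (h : X → ℝ) (F : X → X → X → P) : Prop where
  zeros : ∀ v ∈ D, ∀ a ∈ above D h v, ∀ b ∈ below D h v,
    F v a b ≠ 0 ∧ ev (F v a b) v = 0 ∧ ev (F v a b) a = 0 ∧ ev (F v a b) b = 0
  unique : ∀ v ∈ D, ∀ a ∈ above D h v, ∀ b ∈ below D h v, ∀ p,
    ev p v = 0 → ev p a = 0 → ev p b = 0 → ∃ s : ℝ, p = s • F v a b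
  inj : ∀ v ∈ D, ∀ a ∈ above D h v, ∀ b ∈ below D h v, ∀ a' ∈ above D h v, ∀ b' ∈ below D h v,
    posCount ev (above D h v) (F v a b) = posCount ev (above D h v) (F v a' b') →
    posCount ev (below D h v) (F v a b) = posCount ev (below D h v) (F v a' b') →
    a = a' ∧ b = b'

lemma exists_isFan (H : CircleFamily ev D h) : ∃ F, IsFan ev D h F := by
  have := fun v (hv : v ∈ D) => H.exists_fan hv
  choose! F h1 h2 h3 using this
  exact ⟨F, h1, h2, h3⟩

lemma posCount_lt_card {A : Finset X} {p : P} {a : X} (ha : a ∈ A) (hp : ev p a = 0) :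
    posCount ev A p < A.card :=
  Finset.card_lt_card (Finset.filter_ssubset.2 ⟨a, ha, by simp [hp]⟩)

lemma posCount_above_add_below (H : CircleFamily ev D h) {v : X} (hv : v ∈ D) {p : P}
    (hp : ev p v = 0) :
    posCount ev (above D h v) p + posCount ev (below D h v) p = posCount ev D p := by
  classical
  unfold posCount
  rw [← Finset.card_union_of_disjoint]
  · congr 1
    ext x
    simp only [Finset.mem_union, Finset.mem_filter, mem_above, mem_below]
    constructor
    · tauto
    · rintro ⟨hx, hpx⟩
      rcases lt_trichotomy (h v) (h x) with hlt | heq | hlt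
      · tauto
      · rw [H.height_injOn hv hx heq] at hp
        exact absurd hp hpx.ne'
      · tauto
  · rw [Finset.disjoint_left]
    intro x hx hx'
    simp only [Finset.mem_filter, mem_above, mem_below] at hx hx'
    exact lt_asymm hx.1.2 hx'.1.2

/-- The zeros `a` and `b` keep each count below the size of its part. So the pair of counts is an
injection between finite sets of equal size, hence onto. -/
lemma IsFan.exists_posCount {F : X → X → X → P} (hF : IsFan ev D h F) {v : X} (hv : v ∈ D)
    {i j : ℕ} (hi : i < (above D h v).card) (hj : j < (below D h v).card) :
    ∃ a ∈ above D h v, ∃ b ∈ below D h v, posCount ev (above D h v) (F v a b) = i ∧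
      posCount ev (below D h v) (F v a b) = j := by
  have hsurj := Finset.surjOn_of_injOn_of_card_le (s := above D h v ×ˢ below D h v)
    (t := Finset.range (above D h v).card ×ˢ Finset.range (below D h v).card)
    (fun θ => (posCount ev (above D h v) (F v θ.1 θ.2), posCount ev (below D h v) (F v θ.1 θ.2)))
    (by
      rintro ⟨a, b⟩ hab
      simp only [Finset.coe_product, Set.mem_prod, Finset.mem_coe] at hab
      obtain ⟨-, -, h2, h3⟩ := hF.zeros v hv a hab.1 b hab.2
      simp only [Finset.coe_product, Set.mem_prod, Finset.mem_coe, Finset.mem_range]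
      exact ⟨posCount_lt_card hab.1 h2, posCount_lt_card hab.2 h3⟩)
    (by
      rintro ⟨a, b⟩ hab ⟨a', b'⟩ hab' heq
      simp only [Finset.coe_product, Set.mem_prod, Finset.mem_coe] at hab hab'
      simp only [Prod.mk.injEq] at heq ⊢
      exact hF.inj v hv a hab.1 b hab.2 a' hab'.1 b' hab'.2 heq.1 heq.2)
    (by simp)
  obtain ⟨⟨a, b⟩, hab, heq⟩ := hsurj (show (i, j) ∈ (↑(Finset.range (above D h v).card ×ˢ
    Finset.range (below D h v).card) : Set (ℕ × ℕ)) by simp [hi, hj])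
  simp only [Finset.coe_product, Set.mem_prod, Finset.mem_coe] at hab
  simp only [Prod.mk.injEq] at heq
  exact ⟨a, hab.1, b, hab.2, heq.1, heq.2⟩

/-- Encode a flag by the numbers `i`, `i'` of positive and negative dots above `v`. Then `i + i' +
1` dots lie above `v`, which recovers `v`, and `s - i` is the positive count below, so the fan
recovers `a` and `b`. The only constraints are `i ≤ s` and `i' ≤ m`. -/
lemma IsFan.card_flags_posCount (H : CircleFamily ev D h) {F : X → X → X → P}
    (hF : IsFan ev D h F) {s m : ℕ} (hs : s + m + 3 = D.card) :
    ((flags D h).filter fun θ => posCount ev D (F θ.1 θ.2.1 θ.2.2) = s).card =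
      (s + 1) * (m + 1) := by
  have key : ((flags D h).filter fun θ => posCount ev D (F θ.1 θ.2.1 θ.2.2) = s).card =
      (Finset.range (s + 1) ×ˢ Finset.range (m + 1)).card := by
    refine Finset.card_bij (fun θ _ => (posCount ev (above D h θ.1) (F θ.1 θ.2.1 θ.2.2),
      (above D h θ.1).card - 1 - posCount ev (above D h θ.1) (F θ.1 θ.2.1 θ.2.2))) ?_ ?_ ?_
    · rintro ⟨v, a, b⟩ hθ
      simp only [Finset.mem_filter, mem_flags] at hθ
      obtain ⟨⟨hv, ha, hb⟩, hpos⟩ := hθ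
      obtain ⟨-, h1, h2, h3⟩ := hF.zeros v hv a ha b hb
      have e1 := H.posCount_above_add_below hv h1
      have e2 := H.card_above_add_card_below hv
      have e3 := posCount_lt_card ha h2
      have e4 := posCount_lt_card hb h3
      simp only [Finset.mem_product, Finset.mem_range]
      omega
    · rintro ⟨v, a, b⟩ hθ ⟨v', a', b'⟩ hθ' heq
      simp only [Finset.mem_filter, mem_flags] at hθ hθ'
      obtain ⟨⟨hv, ha, hb⟩, hpos⟩ := hθ
      obtain ⟨⟨hv', ha', hb'⟩, hpos'⟩ := hθ'
      obtain ⟨-, h1, h2, h3⟩ := hF.zeros v hv a ha b hb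
      obtain ⟨-, h1', h2', h3'⟩ := hF.zeros v' hv' a' ha' b' hb'
      have e1 := H.posCount_above_add_below hv h1
      have e1' := H.posCount_above_add_below hv' h1'
      have e3 := posCount_lt_card ha h2
      have e3' := posCount_lt_card ha' h2'
      simp only [Prod.mk.injEq] at heq
      obtain rfl : v = v' := H.card_above_injOn hv hv' (by omega)
      obtain ⟨rfl, rfl⟩ := hF.inj v hv a ha b hb a' ha' b' hb' heq.1 (by omega)
      rfl
    · rintro ⟨i, i'⟩ hi
      simp only [Finset.mem_product, Finset.mem_range] at hi
      -- The extra 1 is the zero `a`, which is neither positive nor negative.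
      obtain ⟨v, hv, hcard⟩ := H.exists_card_above (i := i + 1 + i') (by omega)
      have e2 := H.card_above_add_card_below hv
      obtain ⟨a, ha, b, hb, hpa, hpb⟩ :=
        hF.exists_posCount hv (i := i) (j := s - i) (by omega) (by omega)
      obtain ⟨-, h1, h2, h3⟩ := hF.zeros v hv a ha b hb
      have e1 := H.posCount_above_add_below hv h1
      refine ⟨(v, a, b), ?_, ?_⟩
      · simp only [Finset.mem_filter, mem_flags]
        exact ⟨⟨hv, ha, hb⟩, by omega⟩
      · simp only [Prod.mk.injEq]
        omega
  simpa using key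

/-- The circles of the family, traced on `S`, through three dots with `k` dots on the positive and
`l` dots on the negative side. -/
def circles (ev : P →ₗ[ℝ] X → ℝ) (D : Finset X) (S : Set X) (k l : ℕ) : Set (Set X) :=
  {C | ∃ p, p ≠ 0 ∧ 3 ≤ (D.filter fun x => ev p x = 0).card ∧ C = {x ∈ S | ev p x = 0} ∧
    posCount ev D p = k ∧ posCount ev D (-p) = l}

lemma posCount_add_posCount_neg (D : Finset X) (p : P) :
    posCount ev D p + posCount ev D (-p) + (D.filter fun x => ev p x = 0).card = D.card := by
  classical
  unfold posCount
  rw [← Finset.card_union_of_disjoint, ← Finset.card_union_of_disjoint]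
  · congr 1
    ext x
    simp only [map_neg, Pi.neg_apply, Left.neg_pos_iff, Finset.mem_union, Finset.mem_filter]
    rcases lt_trichotomy (ev p x) 0 with hx | hx | hx <;> tauto
  · rw [Finset.disjoint_left]
    intro x hx hx'
    simp only [map_neg, Pi.neg_apply, Left.neg_pos_iff, Finset.mem_union, Finset.mem_filter]
      at hx hx'
    rcases hx with hx | hx
    · exact hx.2.ne' hx'.2
    · exact hx.2.ne hx'.2
  · rw [Finset.disjoint_left]
    intro x hx hx'
    simp only [map_neg, Pi.neg_apply, Left.neg_pos_iff, Finset.mem_filter] at hx hx'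
    exact lt_asymm hx.2 hx'.2

lemma posCount_smul_of_pos {s : ℝ} (hs : 0 < s) (p : P) :
    posCount ev D (s • p) = posCount ev D p := by
  simp [posCount, hs]

/-- Take the highest and the lowest zero; any third zero lies strictly between them. -/
lemma exists_flag (H : CircleFamily ev D h) {p : P}
    (hp : 3 ≤ (D.filter fun x => ev p x = 0).card) :
    ∃ v ∈ D, ∃ a ∈ above D h v, ∃ b ∈ below D h v, ev p v = 0 ∧ ev p a = 0 ∧ ev p b = 0 := by
  classical
  set Z := D.filter fun x => ev p x = 0 with hZ
  have hne : Z.Nonempty := Finset.card_pos.1 (by omega)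
  obtain ⟨a, ha, hmax⟩ := Z.exists_max_image h hne
  obtain ⟨b, hb, hmin⟩ := Z.exists_min_image h hne
  have hlt : ({a, b} : Finset X).card < Z.card := lt_of_le_of_lt Finset.card_le_two (by omega)
  obtain ⟨v, hv, hvab⟩ := Finset.exists_mem_notMem_of_card_lt_card hlt
  simp only [Finset.mem_insert, Finset.mem_singleton, not_or] at hvab
  have hva := hmax v hv
  have hbv := hmin v hv
  rw [hZ, Finset.mem_filter] at ha hb hv
  refine ⟨v, hv.1, a, mem_above.2 ⟨ha.1, lt_of_le_of_ne hva fun heq => hvab.1 ?_⟩, b,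
    mem_below.2 ⟨hb.1, lt_of_le_of_ne hbv fun heq => hvab.2 ?_⟩, hv.2, ha.2, hb.2⟩
  · exact H.height_injOn hv.1 ha.1 heq
  · exact (H.height_injOn hb.1 hv.1 heq).symm

lemma IsFan.card_zeros (H : CircleFamily ev D h) {F : X → X → X → P} (hF : IsFan ev D h F)
    {v a b : X} (hv : v ∈ D) (ha : a ∈ above D h v) (hb : b ∈ below D h v) :
    (D.filter fun x => ev (F v a b) x = 0).card = 3 := by
  classical
  obtain ⟨h0, h1, h2, h3⟩ := hF.zeros v hv a ha b hb
  have haD := mem_above.1 ha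
  have hbD := mem_below.1 hb
  refine le_antisymm (H.general _ h0) ?_
  have hsub : ({v, a, b} : Finset X) ⊆ D.filter fun x => ev (F v a b) x = 0 := by
    intro y hy
    simp only [Finset.mem_insert, Finset.mem_singleton] at hy
    rw [Finset.mem_filter]
    rcases hy with rfl | rfl | rfl
    · exact ⟨hv, h1⟩
    · exact ⟨haD.1, h2⟩
    · exact ⟨hbD.1, h3⟩
  have h3 : ({v, a, b} : Finset X).card = 3 := by
    rw [Finset.card_eq_three]
    refine ⟨v, a, b, ?_, ?_, ?_, rfl⟩
    · rintro rfl; exact lt_irrefl _ haD.2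
    · rintro rfl; exact lt_irrefl _ hbD.2
    · rintro rfl; exact lt_asymm haD.2 hbD.2
  exact h3 ▸ Finset.card_le_card hsub

/-- The circle of a flag determines the flag. -/
lemma IsFan.injOn (H : CircleFamily ev D h) {F : X → X → X → P} (hF : IsFan ev D h F)
    {S : Set X} (hS : (D : Set X) ⊆ S) :
    Set.InjOn (fun θ : X × X × X => {x ∈ S | ev (F θ.1 θ.2.1 θ.2.2) x = 0}) (flags D h) := by
  rintro ⟨v, a, b⟩ hθ ⟨v', a', b'⟩ hθ' heq
  simp only [Finset.mem_coe, mem_flags] at hθ hθ'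
  obtain ⟨hv, ha, hb⟩ := hθ
  obtain ⟨hv', ha', hb'⟩ := hθ'
  obtain ⟨h0, h1, h2, h3⟩ := hF.zeros v hv a ha b hb
  obtain ⟨-, h1', h2', h3'⟩ := hF.zeros v' hv' a' ha' b' hb'
  have haD' := mem_above.1 ha'
  have hbD' := mem_below.1 hb'
  have haD := mem_above.1 ha
  have hbD := mem_below.1 hb
  have hmem : ∀ x ∈ D, ev (F v' a' b') x = 0 → x = v ∨ x = a ∨ x = b := fun x hx hpx => by
    have : x ∈ {x ∈ S | ev (F v a b) x = 0} := (Set.ext_iff.1 heq x).2 ⟨hS hx, hpx⟩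
    exact H.eq_of_zeros h0 hv ha hb h1 h2 h3 hx this.2
  have hv'' := hmem v' hv' h1'
  have ha'' := hmem a' haD'.1 h2'
  have hb'' := hmem b' hbD'.1 h3'
  have e1 := haD'.2
  have e2 := hbD'.2
  have e3 := haD.2
  have e4 := hbD.2
  -- Only the identity matching of the two triples respects the order of heights.
  rcases hv'' with rfl | rfl | rfl <;> rcases ha'' with rfl | rfl | rfl <;>
    rcases hb'' with rfl | rfl | rfl <;> first | rfl | (exfalso; linarith)

/-- A function cutting out the circle is a multiple `s • F v a b`. Its orientation agrees with that
of the fan for `s > 0` and is opposite for `s < 0`, so the fan's positive count is `k` or `l`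
respectively. -/
lemma IsFan.circles_eq_image (H : CircleFamily ev D h) {F : X → X → X → P}
    (hF : IsFan ev D h F) (S : Set X) {k l : ℕ} (hn : D.card = k + l + 3) :
    circles ev D S k l = (fun θ : X × X × X => {x ∈ S | ev (F θ.1 θ.2.1 θ.2.2) x = 0}) ''
      ((flags D h).filter fun θ => posCount ev D (F θ.1 θ.2.1 θ.2.2) = k ∨
        posCount ev D (F θ.1 θ.2.1 θ.2.2) = l : Finset (X × X × X)) := by
  ext C
  constructor
  · rintro ⟨p, hp, hp3, rfl, hk, hl⟩
    obtain ⟨v, hv, a, ha, b, hb, hpv, hpa, hpb⟩ := H.exists_flag hp3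
    obtain ⟨s, rfl⟩ := hF.unique v hv a ha b hb p hpv hpa hpb
    have hs : s ≠ 0 := by rintro rfl; simp at hp
    refine ⟨(v, a, b), ?_, by simp [hs]⟩
    simp only [Finset.mem_coe, Finset.mem_filter, mem_flags]
    refine ⟨⟨hv, ha, hb⟩, ?_⟩
    rcases hs.lt_or_gt with hs | hs
    · rw [← neg_smul, posCount_smul_of_pos (neg_pos.2 hs)] at hl
      exact Or.inr hl
    · rw [posCount_smul_of_pos hs] at hk
      exact Or.inl hk
  · rintro ⟨⟨v, a, b⟩, hθ, rfl⟩
    simp only [Finset.mem_coe, Finset.mem_filter, mem_flags] at hθ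
    obtain ⟨⟨hv, ha, hb⟩, hpos⟩ := hθ
    have h3 := hF.card_zeros H hv ha hb
    have hsum := posCount_add_posCount_neg (ev := ev) D (F v a b)
    have h0 := (hF.zeros v hv a ha b hb).1
    rcases hpos with hpos | hpos
    · exact ⟨F v a b, h0, h3.ge, rfl, hpos, by omega⟩
    · exact ⟨-F v a b, neg_ne_zero.2 h0, by simp [h3], by simp, by omega,
        by rw [neg_neg]; exact hpos⟩

theorem finite_and_ncard_circles (H : CircleFamily ev D h) {S : Set X} (hS : (D : Set X) ⊆ S)
    {k l : ℕ} (hn : D.card = k + l + 3) :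
    (circles ev D S k l).Finite ∧
      (circles ev D S k l).ncard = if k = l then (k + 1) ^ 2 else 2 * (k + 1) * (l + 1) := by
  classical
  obtain ⟨F, hF⟩ := H.exists_isFan
  rw [hF.circles_eq_image H S hn]
  refine ⟨(Finset.finite_toSet _).image _, ?_⟩
  rw [Set.InjOn.ncard_image ((hF.injOn H hS).mono (by
    rw [Finset.coe_subset]; exact Finset.filter_subset _ _)), Set.ncard_coe_finset]
  have hk := hF.card_flags_posCount H (s := k) (m := l) hn.symm
  have hl := hF.card_flags_posCount H (s := l) (m := k) (by omega)
  -- For `k = l` the two conditions coincide; otherwise they select disjoint sets of flags, of equal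
  -- size.
  split_ifs with hkl
  · subst hkl
    simp only [or_self]
    rw [hk, sq]
  · rw [Finset.filter_or, Finset.card_union_of_disjoint, hk, hl]
    · ring
    · rw [Finset.disjoint_filter]
      intro θ _ h1 h2
      exact hkl (h1.symm.trans h2)

end CircleFamily
end Counting
end Dots

namespace Dots

/-! ### The plane and the sphere as circle families -/

section Instances

open CircleFamily

/-- Some functional is nonzero on the finitely many differences of distinct dots; the Riesz
isomorphism turns it into a vector. This supplies the height. -/
lemma exists_generic_vector {E : Type*} [NormedAddCommGroup E] [InnerProductSpace ℝ E]
    [FiniteDimensional ℝ E] (D : Finset E) :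
    ∃ w : E, Set.InjOn (fun x => inner ℝ w x) (D : Set E) := by
  obtain ⟨φ, hφ⟩ := Module.exists_dual_forall_apply_ne_zero (K := ℝ)
    (fun q : {q : D × D // q.1 ≠ q.2} => (q.1.1 : E) - q.1.2)
    (fun q => sub_ne_zero.2 fun h => q.2 (Subtype.ext h))
  refine ⟨(InnerProductSpace.toDual ℝ E).symm (LinearMap.toContinuousLinearMap φ), ?_⟩
  intro x hx y hy hxy
  simp only [InnerProductSpace.toDual_symm_apply, LinearMap.coe_toContinuousLinearMap'] at hxy
  by_contra hne
  exact hφ ⟨(⟨x, hx⟩, ⟨y, hy⟩), fun h => hne (congrArg Subtype.val h)⟩ (by simp [hxy])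

lemma ncard_inter_setOf {X : Type*} (D : Finset X) (q : X → Prop) [DecidablePred q] :
    ((D : Set X) ∩ {x | q x}).ncard = (D.filter q).card := by
  rw [← Set.ncard_coe_finset]
  congr 1
  ext x
  simp

/-! ### The plane -/

/-- The functions `q ‖x‖² + ⟪m, x⟫ + t` on the plane. -/
noncomputable def planeEval : ℝ × Plane × ℝ →ₗ[ℝ] Plane → ℝ where
  toFun p x := p.1 * ‖x‖ ^ 2 + inner ℝ p.2.1 x + p.2.2
  map_add' p p' := by ext x; simp [inner_add_left]; ring
  map_smul' s p := by ext x; simp [inner_smul_left]; ring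

lemma planeEval_apply (q : ℝ) (m : Plane) (t : ℝ) (x : Plane) :
    planeEval (q, m, t) x = q * ‖x‖ ^ 2 + inner ℝ m x + t := rfl

lemma planeEval_circle (c : Plane) (r : ℝ) (x : Plane) :
    planeEval (1, (-2 : ℝ) • c, ‖c‖ ^ 2 - r ^ 2) x = dist x c ^ 2 - r ^ 2 := by
  rw [planeEval_apply, dist_eq_norm, norm_sub_sq_real, inner_smul_left, real_inner_comm]
  simp
  ring

/-- Completing the square. Here `s` may still be zero or negative; two distinct zeros will exclude
that. -/
lemma planeEval_eq_circle {q : ℝ} (hq : q ≠ 0) (m : Plane) (t : ℝ) :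
    ∃ (c : Plane) (s : ℝ), ∀ x, planeEval (q, m, t) x = q * (dist x c ^ 2 - s) := by
  refine ⟨(-(2 * q)⁻¹) • m, ‖(-(2 * q)⁻¹) • m‖ ^ 2 - t / q, fun x => ?_⟩
  rw [planeEval_apply, dist_eq_norm, norm_sub_sq_real, inner_smul_right, real_inner_comm]
  field_simp
  ring

lemma exists_radius_of_zeros {q : ℝ} (hq : q ≠ 0) (m : Plane) (t : ℝ) {x y : Plane} (hxy : x ≠ y)
    (hx : planeEval (q, m, t) x = 0) (hy : planeEval (q, m, t) y = 0) :
    ∃ (c : Plane) (r : ℝ), 0 < r ∧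
      ∀ x, planeEval (q, m, t) x = q * (dist x c ^ 2 - r ^ 2) := by
  obtain ⟨c, s, hcs⟩ := planeEval_eq_circle hq m t
  have hxs : dist x c ^ 2 = s := by
    rw [hcs] at hx; exact sub_eq_zero.1 ((mul_eq_zero.1 hx).resolve_left hq)
  have hys : dist y c ^ 2 = s := by
    rw [hcs] at hy; exact sub_eq_zero.1 ((mul_eq_zero.1 hy).resolve_left hq)
  have hs : 0 < s := by
    refine lt_of_le_of_ne (hxs ▸ sq_nonneg _) fun h0 => hxy ?_
    rw [← h0] at hxs hys
    rw [dist_eq_zero.1 (pow_eq_zero_iff two_ne_zero |>.1 hxs),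
      dist_eq_zero.1 (pow_eq_zero_iff two_ne_zero |>.1 hys)]
  exact ⟨c, √s, Real.sqrt_pos.2 hs, fun x => by rw [hcs, Real.sq_sqrt hs.le]⟩

lemma sphere_eq_setOf_planeEval {q : ℝ} (hq : q ≠ 0) {m : Plane} {t : ℝ} {c : Plane} {r : ℝ}
    (hr : 0 < r) (h : ∀ x, planeEval (q, m, t) x = q * (dist x c ^ 2 - r ^ 2)) :
    {x | planeEval (q, m, t) x = 0} = Metric.sphere c r := by
  ext x
  rw [Set.mem_ofPred_eq, h, Metric.mem_sphere, mul_eq_zero, or_iff_right hq, sub_eq_zero,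
    sq_eq_sq₀ dist_nonneg hr.le]

/-- All differences lie in the orthogonal complement of `m`, which is one-dimensional in the plane.
-/
lemma collinear_of_inner_eq {m : Plane} (hm : m ≠ 0) {t : ℝ} {T : Set Plane}
    (hT : ∀ x ∈ T, inner ℝ m x = t) : Collinear ℝ T := by
  rw [collinear_iff_finrank_le_one]
  have : Fact (Module.finrank ℝ Plane = 1 + 1) := ⟨by simp⟩
  rw [← Submodule.finrank_orthogonal_span_singleton (𝕜 := ℝ) (n := 1) hm]
  apply Submodule.finrank_mono
  rw [vectorSpan_def, Submodule.span_le]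
  rintro _ ⟨x, hx, y, hy, rfl⟩
  rw [SetLike.mem_coe, Submodule.mem_orthogonal_singleton_iff_inner_right]
  simp [inner_sub_right, hT x hx, hT y hy]

/-- A nonzero circle function vanishing at three dots is not affine. -/
lemma fst_ne_zero_of_zeros {D : Finset Plane} (hD : PlaneGeneralPosition D) {q : ℝ} {m : Plane}
    {t : ℝ} (hp : (q, m, t) ≠ 0)
    (h3 : 3 ≤ (D.filter fun x => planeEval (q, m, t) x = 0).card) : q ≠ 0 := by
  rintro rfl
  obtain ⟨T, hT, hcard⟩ := Finset.exists_subset_card_eq h3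
  have hT0 : ∀ x ∈ T, inner ℝ m x + t = 0 := fun x hx => by
    simpa [planeEval_apply] using (Finset.mem_filter.1 (hT hx)).2
  by_cases hm : m = 0
  · subst hm
    obtain ⟨x, hx⟩ := Finset.card_pos.1 (hcard ▸ three_pos : 0 < T.card)
    have := hT0 x hx
    simp at this
    simp [this] at hp
  · exact hD.2 T (hT.trans (Finset.filter_subset _ _)) hcard
      (collinear_of_inner_eq hm (t := -t) fun x hx => by linarith [hT0 x hx])

lemma circleFamily_plane {D : Finset Plane} (hD : PlaneGeneralPosition D) {w : Plane}
    (hw : Set.InjOn (fun x => inner ℝ w x) (D : Set Plane)) :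
    CircleFamily planeEval D (fun x => inner ℝ w x) where
  finrank := by simp
  height_injOn := hw
  general := by
    rintro ⟨q, m, t⟩ hp
    by_contra! h4
    have hq := fst_ne_zero_of_zeros hD hp (by omega)
    obtain ⟨T, hT, hcard⟩ := Finset.exists_subset_card_eq (show 4 ≤ _ from h4)
    obtain ⟨x, hx, y, hy, hxy⟩ := Finset.one_lt_card.1 (show 1 < T.card by omega)
    have hT0 := fun x (hx : x ∈ T) => (Finset.mem_filter.1 (hT hx)).2
    obtain ⟨c, r, hr, h⟩ := exists_radius_of_zeros hq m t hxy (hT0 x hx) (hT0 y hy)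
    refine hD.1 T (hT.trans (Finset.filter_subset _ _)) hcard _ ⟨c, r, hr, rfl⟩ ?_
    rw [← sphere_eq_setOf_planeEval hq hr h]
    exact hT0
  const := ⟨(0, 0, 1), fun x => by simp [planeEval_apply]⟩
  height := ⟨(0, w, 0), fun x => by simp [planeEval_apply]⟩
  support := fun v _ => by
    -- The squared distance to `v`, a circle of radius zero, serves as supporting function.
    refine ⟨(1, (-2 : ℝ) • v, ‖v‖ ^ 2 - 0 ^ 2), ?_, fun x _ hx => ?_⟩
    · rw [planeEval_circle]; simp
    · rw [planeEval_circle]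
      have := dist_pos.2 hx
      nlinarith

lemma setOf_dist_lt {q : ℝ} (hq : 0 < q) {m : Plane} {t : ℝ} {c : Plane} {r : ℝ} (hr : 0 < r)
    (h : ∀ x, planeEval (q, m, t) x = q * (dist x c ^ 2 - r ^ 2)) :
    {x | r < dist x c} = {x | 0 < planeEval (q, m, t) x} ∧
      {x | dist x c < r} = {x | 0 < planeEval (-(q, m, t)) x} := by
  constructor <;> ext x
  · rw [Set.mem_ofPred_eq, Set.mem_ofPred_eq, h, mul_pos_iff_of_pos_left hq, sub_pos,
      sq_lt_sq₀ hr.le dist_nonneg]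
  · rw [Set.mem_ofPred_eq, Set.mem_ofPred_eq, map_neg, Pi.neg_apply, h, ← mul_neg, neg_sub,
      mul_pos_iff_of_pos_left hq, sub_pos, sq_lt_sq₀ dist_nonneg hr.le]

lemma planeIncidentCircles_eq {D : Finset Plane} (hD : PlaneGeneralPosition D) (k l : ℕ) :
    planeIncidentCircles D k l = circles planeEval D Set.univ k l := by
  ext C
  constructor
  · rintro ⟨-, ⟨T, hT, hcard, hTC⟩, A, B, ⟨c, r, hr, rfl, hAB⟩, hA, hB⟩
    set p : ℝ × Plane × ℝ := (1, (-2 : ℝ) • c, ‖c‖ ^ 2 - r ^ 2) with hp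
    have hp0 : p ≠ 0 := fun h => one_ne_zero (congrArg Prod.fst h : (1 : ℝ) = 0)
    have hpe : ∀ x, planeEval p x = 1 * (dist x c ^ 2 - r ^ 2) := fun x => by
      rw [one_mul]; exact planeEval_circle c r x
    have hzero := sphere_eq_setOf_planeEval one_ne_zero hr hpe
    obtain ⟨hout, hin⟩ := setOf_dist_lt one_pos hr hpe
    rw [← hp] at hzero hout hin
    have h3 : 3 ≤ (D.filter fun x => planeEval p x = 0).card := by
      rw [← hcard]
      refine Finset.card_le_card fun x hx => Finset.mem_filter.2 ⟨hT hx, ?_⟩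
      have : x ∈ Metric.sphere c r := hTC hx
      rwa [← hzero] at this
    rcases hAB with ⟨rfl, rfl⟩ | ⟨rfl, rfl⟩
    · rw [hin, ncard_inter_setOf] at hA
      rw [hout, ncard_inter_setOf] at hB
      exact ⟨-p, neg_ne_zero.2 hp0, by simpa using h3, by rw [← hzero]; simp, hA,
        by rw [neg_neg]; exact hB⟩
    · rw [hout, ncard_inter_setOf] at hA
      rw [hin, ncard_inter_setOf] at hB
      exact ⟨p, hp0, h3, by rw [← hzero]; simp, hA, hB⟩
  · rintro ⟨⟨q, m, t⟩, hp, h3, rfl, hk, hl⟩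
    -- Straight lines are zero sets of the family too; this rules them out.
    have hq := fst_ne_zero_of_zeros hD hp h3
    obtain ⟨T, hT, hcard⟩ := Finset.exists_subset_card_eq h3
    obtain ⟨x, hx, y, hy, hxy⟩ := Finset.one_lt_card.1 (show 1 < T.card by omega)
    have hT0 := fun x (hx : x ∈ T) => (Finset.mem_filter.1 (hT hx)).2
    obtain ⟨c, r, hr, h⟩ := exists_radius_of_zeros hq m t hxy (hT0 x hx) (hT0 y hy)
    have hzero := sphere_eq_setOf_planeEval hq hr h
    have hC : {x ∈ Set.univ | planeEval (q, m, t) x = 0} = Metric.sphere c r := by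
      rw [← hzero]; simp
    rw [hC]
    refine ⟨⟨c, r, hr, rfl⟩, ⟨T, hT.trans (Finset.filter_subset _ _), hcard, ?_⟩, ?_⟩
    · rw [← hzero]; exact hT0
    rcases hq.lt_or_gt with hq | hq
    -- For `q < 0` the inside is the positive side, so the negated function is used.
    · obtain ⟨hout, hin⟩ := setOf_dist_lt (q := -q) (m := -m) (t := -t) (neg_pos.2 hq) hr
        (fun x => by
          have := h x
          rw [planeEval_apply] at this ⊢
          rw [inner_neg_left]
          linarith)
      have hneg : ((-q, -m, -t) : ℝ × Plane × ℝ) = -(q, m, t) := rfl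
      rw [hneg] at hout hin
      rw [neg_neg] at hin
      refine ⟨_, _, ⟨c, r, hr, rfl, Or.inl ⟨rfl, rfl⟩⟩, ?_, ?_⟩
      · rw [hin, ncard_inter_setOf]; exact hk
      · rw [hout, ncard_inter_setOf]; exact hl
    · obtain ⟨hout, hin⟩ := setOf_dist_lt hq hr h
      refine ⟨_, _, ⟨c, r, hr, rfl, Or.inr ⟨rfl, rfl⟩⟩, ?_, ?_⟩
      · rw [hout, ncard_inter_setOf]; exact hk
      · rw [hin, ncard_inter_setOf]; exact hl

/-! ### The sphere -/

/-- The functions `⟪m, x⟫ - t` on space. -/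
noncomputable def spaceEval : Space × ℝ →ₗ[ℝ] Space → ℝ where
  toFun p x := inner ℝ p.1 x - p.2
  map_add' p p' := by ext x; simp [inner_add_left]; ring
  map_smul' s p := by ext x; simp [inner_smul_left]; ring

lemma spaceEval_apply (m : Space) (t : ℝ) (x : Space) :
    spaceEval (m, t) x = inner ℝ m x - t := rfl

/-- A nonzero affine function with a zero is not constant. -/
lemma fst_ne_zero_of_zero {m : Space} {t : ℝ} (hp : (m, t) ≠ 0) {x : Space}
    (hx : spaceEval (m, t) x = 0) : m ≠ 0 := by
  rintro rfl
  simp only [spaceEval_apply, inner_zero_left, zero_sub, neg_eq_zero] at hx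
  simp [hx] at hp

/-- The tangent plane at `v` meets the sphere only in `v`: the difference equals `‖x - v‖² / 2`.
This gives the supporting functions. -/
lemma inner_sub_center_pos {o v x : Space} {R : ℝ} (hv : v ∈ Metric.sphere o R)
    (hx : x ∈ Metric.sphere o R) (hne : x ≠ v) : 0 < inner ℝ (o - v) x - inner ℝ (o - v) v := by
  rw [mem_sphere_iff_norm] at hv hx
  have h1 := norm_sub_sq_real (x - o) (v - o)
  rw [sub_sub_sub_cancel_right, hv, hx] at h1
  have h2 : 0 < ‖x - v‖ := norm_pos_iff.2 (sub_ne_zero.2 hne)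
  have h3 : inner ℝ (v - o) (v - o) = R ^ 2 := by rw [real_inner_self_eq_norm_sq, hv]
  have h4 : inner ℝ (o - v) x - inner ℝ (o - v) v =
      inner ℝ (v - o) (v - o) - inner ℝ (x - o) (v - o) := by
    simp only [inner_sub_left, inner_sub_right]
    linarith [real_inner_comm v o, real_inner_comm x v, real_inner_comm x o]
  rw [h4, h3]
  nlinarith

lemma circleFamily_sphere {o : Space} {R : ℝ} {D : Finset Space}
    (hDs : (D : Set Space) ⊆ Metric.sphere o R) (hD : SphereGeneralPosition o R D) {w : Space}
    (hw : Set.InjOn (fun x => inner ℝ w x) (D : Set Space)) :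
    CircleFamily spaceEval D (fun x => inner ℝ w x) where
  finrank := by simp
  height_injOn := hw
  general := by
    rintro ⟨m, t⟩ hp
    by_contra! h4
    obtain ⟨T, hT, hcard⟩ := Finset.exists_subset_card_eq (show 4 ≤ _ from h4)
    obtain ⟨x, hx, y, hy, hxy⟩ := Finset.one_lt_card.1 (show 1 < T.card by omega)
    have hT0 : ∀ x ∈ T, x ∈ {x ∈ Metric.sphere o R | inner ℝ m x = t} := fun x hx =>
      ⟨hDs (Finset.mem_filter.1 (hT hx)).1, sub_eq_zero.1 (Finset.mem_filter.1 (hT hx)).2⟩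
    exact hD T (hT.trans (Finset.filter_subset _ _)) hcard _
      ⟨⟨x, hT0 x hx, y, hT0 y hy, hxy⟩, m, t,
        fst_ne_zero_of_zero hp (Finset.mem_filter.1 (hT hx)).2, rfl⟩ hT0
  const := ⟨(0, -1), fun x => by simp [spaceEval_apply]⟩
  height := ⟨(w, 0), fun x => by simp [spaceEval_apply]⟩
  support := fun v hv => ⟨(o - v, inner ℝ (o - v) v), by simp [spaceEval_apply],
    fun x hx hne => inner_sub_center_pos (hDs hv) (hDs hx) hne⟩

lemma sphereIncidentCircles_eq {o : Space} {R : ℝ} {D : Finset Space}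
    (hDs : (D : Set Space) ⊆ Metric.sphere o R) (k l : ℕ) :
    sphereIncidentCircles o R D k l = circles spaceEval D (Metric.sphere o R) k l := by
  have hpos : ∀ m t, ((D : Set Space) ∩ {x ∈ Metric.sphere o R | t < inner ℝ m x}).ncard =
      posCount spaceEval D (m, t) := fun m t => by
    rw [posCount, ← ncard_inter_setOf]
    congr 1
    ext x
    simp only [spaceEval_apply, sub_pos]
    exact ⟨fun h => ⟨h.1, h.2.2⟩, fun h => ⟨h.1, hDs h.1, h.2⟩⟩
  have hneg : ∀ m t, ((D : Set Space) ∩ {x ∈ Metric.sphere o R | inner ℝ m x < t}).ncard =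
      posCount spaceEval D (-(m, t)) := fun m t => by
    rw [Prod.neg_mk, ← hpos]
    simp
  have hzero : ∀ m t, {x ∈ Metric.sphere o R | spaceEval (-(m, t)) x = 0} =
      {x ∈ Metric.sphere o R | inner ℝ m x = t} := fun m t => by
    simp only [map_neg, Pi.neg_apply, neg_eq_zero, spaceEval_apply, sub_eq_zero]
  ext C
  constructor
  · rintro ⟨-, ⟨T, hT, hcard, hTC⟩, A, B, ⟨-, m, t, hm, rfl, rfl, rfl⟩, hA, hB⟩
    rw [hneg] at hA
    rw [hpos] at hB
    -- The sign is needed because `AreSphereSides` lists the lower cap first, while `circles` counts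
    -- `k` on the positive side.
    refine ⟨-(m, t), neg_ne_zero.2 fun h => hm (congrArg Prod.fst h), ?_, ?_, hA, ?_⟩
    · refine hcard.ge.trans ?_
      refine Finset.card_le_card fun x hx => Finset.mem_filter.2 ⟨hT hx, ?_⟩
      have : inner ℝ m x = t := (hTC hx).2
      simp [spaceEval_apply, this]
    · exact (hzero m t).symm
    · rw [neg_neg]; exact hB
  · rintro ⟨p, hp, h3, rfl, hk, hl⟩
    obtain ⟨⟨m, t⟩, rfl⟩ : ∃ p', p = -p' := ⟨-p, (neg_neg p).symm⟩
    rw [neg_neg] at hl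
    rw [neg_ne_zero] at hp
    obtain ⟨T, hT, hcard⟩ := Finset.exists_subset_card_eq h3
    obtain ⟨x, hx, y, hy, hxy⟩ := Finset.one_lt_card.1 (show 1 < T.card by omega)
    have hT0 : ∀ x ∈ T, x ∈ {x ∈ Metric.sphere o R | inner ℝ m x = t} := fun x hx => by
      rw [← hzero]
      exact ⟨hDs (Finset.mem_filter.1 (hT hx)).1, (Finset.mem_filter.1 (hT hx)).2⟩
    have hm : m ≠ 0 := fst_ne_zero_of_zero hp (sub_eq_zero.2 (hT0 x hx).2)
    rw [hzero]
    have hnt : {x ∈ Metric.sphere o R | inner ℝ m x = t}.Nontrivial :=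
      ⟨x, hT0 x hx, y, hT0 y hy, hxy⟩
    exact ⟨⟨hnt, m, t, hm, rfl⟩, ⟨T, hT.trans (Finset.filter_subset _ _), hcard, hT0⟩, _, _,
      ⟨hnt, m, t, hm, rfl, rfl, rfl⟩, (hneg m t).trans hk, (hpos m t).trans hl⟩

end Instances

end Dots

theorem theoremA (k l : ℕ) :
    (∀ D : Finset Dots.Plane, D.card = k + l + 3 → Dots.PlaneGeneralPosition D →
      (Dots.planeIncidentCircles D k l).Finite ∧
      (Dots.planeIncidentCircles D k l).ncard =
        if k = l then (k + 1) ^ 2 else 2 * (k + 1) * (l + 1)) ∧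
    (∀ (o : Dots.Space) (R : ℝ), 0 < R →
      ∀ D : Finset Dots.Space, (D : Set Dots.Space) ⊆ Metric.sphere o R →
        D.card = k + l + 3 → Dots.SphereGeneralPosition o R D →
        (Dots.sphereIncidentCircles o R D k l).Finite ∧
        (Dots.sphereIncidentCircles o R D k l).ncard =
          if k = l then (k + 1) ^ 2 else 2 * (k + 1) * (l + 1)) := by
  constructor
  · intro D hn hD
    obtain ⟨w, hw⟩ := Dots.exists_generic_vector D
    rw [Dots.planeIncidentCircles_eq hD]
    exact (Dots.circleFamily_plane hD hw).finite_and_ncard_circles (Set.subset_univ _) hn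
  · intro o R _ D hDs hn hD
    obtain ⟨w, hw⟩ := Dots.exists_generic_vector D
    rw [Dots.sphereIncidentCircles_eq hDs]
    exact (Dots.circleFamily_sphere hDs hD hw).finite_and_ncard_circles hDs hn
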